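/- All rings are associative with $1$ and are algebras over a commutative ring $K$ (for instance $K=\mathbb{Z}$). Let $R$ be a ring and let $\mathcal{C}_R$ be its set of regular elements (neither left nor right zero divisors). A multiplicative set of $R$ is a submonoid $S$ of $(R,\cdot)$ with $0\notin S$. For such an $S$ let $R\langle S^{-1}\rangle$ be the quotient of the $K$-algebra freely generated by $R$ and noncommuting indeterminates $x_s$ $(s\in S)$ by the ideal generated by all $sx_s-1$ and $x_ss-1$. The set $S$ is called left localizable if $R\langle S^{-1}\rangle\neq 0$ and every element of $R\langle S^{-1}\rangle$ has the form $\bar s^{-1}\bar r$, where $\bar s,\bar r$ are the images of some $s\in S$, $r\in R$. It is called a left denominator set if $Sr\cap Rs\neq\emptyset$ for all $r\in R$, $s\in S$, and if $rs=0$ with $r\in R$, $s\in S$ implies $tr=0$ for some $t\in S$. Let $\max\mathbb{L}_l(R)$ and $\max\mathrm{Den}_l(R)$ be the sets of maximal (with respect to inclusion) left localizable sets and of maximal left denominator sets of $R$, let $\min(R)$ be the set of minimal prime (two-sided) ideals of $R$, and put $\mathcal{C}(\mathfrak{p})=\{c\in R \mid c+\mathfrak{p}\in\mathcal{C}_{R/\mathfrak{p}}\}$.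 **Theorem.** Let $R$ be a semiprime left Goldie ring (semiprime, of finite left uniform dimension, and with the ascending chain condition on left annihilators). Then $$\{S\in\max\mathbb{L}_l(R) \mid \mathcal{C}_R\subseteq S\}=\max\mathrm{Den}_l(R)=\{\mathcal{C}(\mathfrak{p}) \mid \mathfrak{p}\in\min(R)\}.$$ -/

import Mathlib

universe u v w

/-! ### Semiprime left Goldie rings -/

/-- A ring is semiprime if `a R a = 0` implies `a = 0`. -/
def IsSemiprimeRing (R : Type u) [Ring R] : Prop :=
  ∀ a : R, (∀ r : R, a * r * a = 0) → a = 0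

/-- The left annihilator `{r | r x = 0 for all x ∈ X}`, a left ideal. -/
def leftAnnihilator {R : Type u} [Ring R] (X : Set R) : Ideal R where
  carrier := {r | ∀ x ∈ X, r * x = 0}
  zero_mem' := fun x _ => zero_mul x
  add_mem' := fun {a b} ha hb x hx => by rw [add_mul, ha x hx, hb x hx, add_zero]
  smul_mem' := fun c r hr x hx => by rw [smul_eq_mul, mul_assoc, hr x hx, mul_zero]

/-- `R` has finite left uniform dimension: there is no infinite direct sum of nonzero left
ideals in `R`. -/
def HasFiniteLeftUniformDim (R : Type u) [Ring R] : Prop :=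
  ¬ ∃ J : ℕ → Ideal R, (∀ n, J n ≠ ⊥) ∧ iSupIndep J

/-- The ascending chain condition on left annihilators. -/
def HasACCLeftAnnihilators (R : Type u) [Ring R] : Prop :=
  WellFoundedGT {J : Ideal R // ∃ X : Set R, J = leftAnnihilator X}

/-- A left Goldie ring: finite left uniform dimension and the ascending chain condition on left
annihilators. -/
structure IsLeftGoldieRing (R : Type u) [Ring R] : Prop where
  finite_udim : HasFiniteLeftUniformDim R
  acc_leftAnnihilators : HasACCLeftAnnihilators R

/-! ### Minimal primes and the sets `C(p)` -/

/-- A prime (two-sided) ideal of a not necessarily commutative ring: `P ≠ R`, and `a R b ⊆ P`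
implies `a ∈ P` or `b ∈ P`. -/
def IsPrimeTwoSided {R : Type u} [Ring R] (P : TwoSidedIdeal R) : Prop :=
  P ≠ ⊤ ∧ ∀ a b : R, (∀ r : R, a * r * b ∈ P) → a ∈ P ∨ b ∈ P

/-- The set `min(R)` of minimal prime ideals of `R`. -/
def minPrimes (R : Type u) [Ring R] : Set (TwoSidedIdeal R) :=
  {P | Minimal IsPrimeTwoSided P}

/-- `C(p) = {c ∈ R | c + p is a regular element of R/p}`, where regular means neither a left nor
a right zero divisor. -/
def regularModulo {R : Type u} [Ring R] (p : TwoSidedIdeal R) : Submonoid R :=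
  (nonZeroDivisors p.ringCon.Quotient).comap p.ringCon.mk'

/-! ### Left denominator sets -/

/-- A left denominator set: a multiplicative set (a submonoid without `0`) that is a left Ore set
and such that `r s = 0` with `s ∈ S` implies `t r = 0` for some `t ∈ S`. The last two properties
are what `OreLocalization.OreSet` records, see `isLeftDenominatorSet_iff`. -/
def IsLeftDenominatorSet {R : Type u} [Ring R] (S : Submonoid R) : Prop :=
  (0 : R) ∉ S ∧ Nonempty (OreLocalization.OreSet S)

theorem isLeftDenominatorSet_iff {R : Type u} [Ring R] (S : Submonoid R) :
    IsLeftDenominatorSet S ↔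
      (0 : R) ∉ S ∧
      (∀ r : R, ∀ s ∈ S, ∃ s' ∈ S, ∃ r' : R, s' * r = r' * s) ∧
      (∀ r : R, ∀ s ∈ S, r * s = 0 → ∃ t ∈ S, t * r = 0) := by
  refine and_congr_right fun _ => ⟨?_, ?_⟩
  · rintro ⟨h⟩
    refine ⟨fun r s hs => ⟨_, (h.oreDenom r ⟨s, hs⟩).2, _, h.ore_eq r ⟨s, hs⟩⟩, fun r s hs h0 => ?_⟩
    obtain ⟨t, ht⟩ := h.ore_right_cancel r 0 ⟨s, hs⟩ (by simpa using h0)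
    exact ⟨t, t.2, by simpa using ht⟩
  · rintro ⟨h₁, h₂⟩
    choose d hd n hn using h₁
    refine ⟨⟨fun r₁ r₂ s h => ?_, fun r s => n r s s.2, fun r s => ⟨d r s s.2, hd r s s.2⟩,
      fun r s => hn r s s.2⟩⟩
    obtain ⟨t, ht, h0⟩ := h₂ (r₁ - r₂) s s.2 (by rw [sub_mul, h, sub_self])
    exact ⟨⟨t, ht⟩, by rwa [mul_sub, sub_eq_zero] at h0⟩

/-! ### The rings `R⟨X⟩` and `R⟨S⁻¹⟩` -/

/-- The relations saying that `R → R⟨X⟩` is a homomorphism of `K`-algebras. -/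
inductive FreeExtRel (K : Type v) (R : Type u) [CommRing K] [Ring R] [Algebra K R] (X : Type w) :
    FreeAlgebra K (R ⊕ X) → FreeAlgebra K (R ⊕ X) → Prop
  | add (a b : R) : FreeExtRel K R X (FreeAlgebra.ι K (Sum.inl (a + b)))
      (FreeAlgebra.ι K (Sum.inl a) + FreeAlgebra.ι K (Sum.inl b))
  | mul (a b : R) : FreeExtRel K R X (FreeAlgebra.ι K (Sum.inl (a * b)))
      (FreeAlgebra.ι K (Sum.inl a) * FreeAlgebra.ι K (Sum.inl b))
  | scalar (k : K) : FreeExtRel K R X (FreeAlgebra.ι K (Sum.inl (algebraMap K R k)))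
      (algebraMap K (FreeAlgebra K (R ⊕ X)) k)

/-- The `K`-algebra `R⟨X⟩` freely generated by the `K`-algebra `R` and a set `X` of free
noncommuting indeterminates. -/
abbrev FreeExt (K : Type v) (R : Type u) [CommRing K] [Ring R] [Algebra K R] (X : Type w) :
    Type (max u v w) :=
  RingQuot (FreeExtRel K R X)

namespace FreeExt

/-- The canonical homomorphism `R → R⟨X⟩`. -/
noncomputable def incl (K : Type v) (R : Type u) [CommRing K] [Ring R] [Algebra K R]
    (X : Type w) : R →ₐ[K] FreeExt K R X :=
  have hscalar : ∀ k : K, RingQuot.mkAlgHom K (FreeExtRel K R X)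
      (FreeAlgebra.ι K (Sum.inl (algebraMap K R k))) = algebraMap K (FreeExt K R X) k := fun k => by
    rw [RingQuot.mkAlgHom_rel K (FreeExtRel.scalar k), AlgHom.commutes]
  { toFun := fun r => RingQuot.mkAlgHom K (FreeExtRel K R X) (FreeAlgebra.ι K (Sum.inl r))
    map_one' := by simpa using hscalar 1
    map_mul' := fun a b => by
      rw [RingQuot.mkAlgHom_rel K (FreeExtRel.mul a b), map_mul]
    map_zero' := by simpa using hscalar 0
    map_add' := fun a b => by
      rw [RingQuot.mkAlgHom_rel K (FreeExtRel.add a b), map_add]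
    commutes' := hscalar }

/-- The indeterminate of `R⟨X⟩` with index `x`. -/
noncomputable def var (K : Type v) (R : Type u) [CommRing K] [Ring R] [Algebra K R]
    {X : Type w} (x : X) : FreeExt K R X :=
  RingQuot.mkAlgHom K (FreeExtRel K R X) (FreeAlgebra.ι K (Sum.inr x))

end FreeExt

/-- The relations `s x_s = 1` and `x_s s = 1` for `s ∈ S`. -/
inductive InvertRel (K : Type v) {R : Type u} [CommRing K] [Ring R] [Algebra K R]
    (S : Submonoid R) : FreeExt K R S → FreeExt K R S → Prop
  | mul_inv (s : S) : InvertRel K S (FreeExt.incl K R S s * FreeExt.var K R s) 1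
  | inv_mul (s : S) : InvertRel K S (FreeExt.var K R s * FreeExt.incl K R S s) 1

/-- The ring `R⟨S⁻¹⟩`, the quotient of `R⟨X_S⟩` by the ideal generated by all the elements
`s x_s - 1` and `x_s s - 1`, `s ∈ S`. -/
abbrev Inverted (K : Type v) {R : Type u} [CommRing K] [Ring R] [Algebra K R]
    (S : Submonoid R) : Type (max u v) :=
  RingQuot (InvertRel K S)

namespace Inverted

/-- The canonical homomorphism `R → R⟨S⁻¹⟩`. -/
noncomputable def of (K : Type v) {R : Type u} [CommRing K] [Ring R] [Algebra K R]
    (S : Submonoid R) : R →ₐ[K] Inverted K S :=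
  (RingQuot.mkAlgHom K (InvertRel K S)).comp (FreeExt.incl K R S)

/-- The element `x_s` of `R⟨S⁻¹⟩`, the inverse of the image of `s`. -/
noncomputable def inv (K : Type v) {R : Type u} [CommRing K] [Ring R] [Algebra K R]
    (S : Submonoid R) (s : S) : Inverted K S :=
  RingQuot.mkAlgHom K (InvertRel K S) (FreeExt.var K R s)

end Inverted

/-- A left localizable set: a multiplicative set `S` (a submonoid without `0`) such that the ring
`R⟨S⁻¹⟩` is nonzero and each of its elements is a left fraction, that is, the product of the
inverse of the image of some `s ∈ S` and of the image of some `r ∈ R`. -/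
structure IsLeftLocalizableSet (K : Type v) {R : Type u} [CommRing K] [Ring R] [Algebra K R]
    (S : Submonoid R) : Prop where
  zero_notMem : (0 : R) ∉ S
  nontrivial : Nontrivial (Inverted K S)
  exists_fraction : ∀ z : Inverted K S, ∃ (s : S) (r : R), z = Inverted.inv K S s * Inverted.of K S r

/-! ### Uniform dimension and essential left ideals -/

section Goldie

variable {R : Type u} [Ring R]

/-- A sequence of left ideals `J n ≤ L n` such that `L` is antitone and `J n` is disjoint from
`L (n + 1)` is independent. -/
theorem iSupIndep_of_antitone {L J : ℕ → Ideal R} (hL : Antitone L) (hJ : ∀ n, J n ≤ L n)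
    (hd : ∀ n, Disjoint (J n) (L (n + 1))) : iSupIndep J := by
  rw [iSupIndep_iff_finsetSum_eq_zero_imp_eq_zero]
  intro s v hv hsum i
  induction i using Nat.strong_induction_on with
  | _ i ih =>
    intro hi
    refine Submodule.disjoint_def.1 (hd i) _ (hv i hi) ?_
    have h1 : v i = -∑ j ∈ s.erase i, v j := by
      rw [← s.add_sum_erase _ hi] at hsum
      exact eq_neg_of_add_eq_zero_left hsum
    rw [h1]
    refine neg_mem (sum_mem fun j hj => ?_)
    obtain ⟨hji, hjs⟩ := Finset.mem_erase.1 hj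
    rcases lt_or_gt_of_ne hji with h | h
    · rw [ih j h hjs]
      exact zero_mem _
    · exact hL h (hJ j (hv j hjs))

theorem HasFiniteLeftUniformDim.exists_eq_bot (h : HasFiniteLeftUniformDim R) {L J : ℕ → Ideal R}
    (hL : Antitone L) (hJ : ∀ n, J n ≤ L n) (hd : ∀ n, Disjoint (J n) (L (n + 1))) :
    ∃ n, J n = ⊥ := by
  by_contra hne
  push Not at hne
  exact h ⟨J, hne, iSupIndep_of_antitone hL hJ hd⟩

/-- A left ideal is essential if it meets every nonzero left ideal nontrivially. -/
def IsEssentialLeft (E : Ideal R) : Prop :=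
  ∀ x : R, x ≠ 0 → ∃ r : R, r * x ∈ E ∧ r * x ≠ 0

theorem IsEssentialLeft.mono {E F : Ideal R} (hE : IsEssentialLeft E) (h : E ≤ F) :
    IsEssentialLeft F := fun x hx => by
  obtain ⟨r, hr, h0⟩ := hE x hx
  exact ⟨r, h hr, h0⟩

/-- The left ideal `{x | x r ∈ E}`. -/
def Ideal.colonRight (E : Ideal R) (r : R) : Ideal R :=
  Submodule.comap (LinearMap.toSpanSingleton R R r) E

theorem Ideal.mem_colonRight {E : Ideal R} {r x : R} : x ∈ E.colonRight r ↔ x * r ∈ E := Iff.rfl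

theorem IsEssentialLeft.colonRight {E : Ideal R} (hE : IsEssentialLeft E) (r : R) :
    IsEssentialLeft (E.colonRight r) := fun x hx => by
  by_cases h : x * r = 0
  · exact ⟨1, by rw [one_mul, Ideal.mem_colonRight, h]; exact zero_mem _, by rwa [one_mul]⟩
  · obtain ⟨t, ht, h0⟩ := hE _ h
    refine ⟨t, by rwa [Ideal.mem_colonRight, mul_assoc], fun h1 => h0 ?_⟩
    rw [← mul_assoc, h1, zero_mul]

/-- The left ideal `I c`. -/
def Ideal.mulRight (I : Ideal R) (c : R) : Ideal R :=
  Submodule.map (LinearMap.toSpanSingleton R R c) I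

theorem Ideal.mem_mulRight {I : Ideal R} {c x : R} : x ∈ I.mulRight c ↔ ∃ y ∈ I, y * c = x :=
  Iff.rfl

/-- If `R` has finite left uniform dimension and right multiplication by `c` is an injective
endomorphism of the left ideal `I`, then its image is essential in `I`. -/
theorem HasFiniteLeftUniformDim.exists_mul_mem_mulRight (h : HasFiniteLeftUniformDim R)
    {I : Ideal R} {c : R} (hI : ∀ y ∈ I, y * c ∈ I) (hc : ∀ y ∈ I, y * c = 0 → y = 0)
    {x : R} (hx : x ∈ I) (hx0 : x ≠ 0) : ∃ r, r * x ∈ I.mulRight c ∧ r * x ≠ 0 := by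
  by_contra hcon
  push Not at hcon
  have hcn : ∀ n : ℕ, ∀ y ∈ I, y * c ^ n = 0 → y = 0 := by
    intro n
    induction n with
    | zero => simp
    | succ n ih =>
      intro y hy h0
      rw [pow_succ', ← mul_assoc] at h0
      exact hc y hy (ih _ (hI y hy) h0)
  have hspan : ∀ y ∈ Ideal.span {x}, ∃ r, r * x = y := fun y hy => by
    simpa [eq_comm] using Ideal.mem_span_singleton'.1 hy
  have hL : Antitone fun n => I.mulRight (c ^ n) := antitone_nat_of_succ_le fun n y hy => by
    obtain ⟨z, hz, rfl⟩ := Ideal.mem_mulRight.1 hy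
    exact Ideal.mem_mulRight.2 ⟨z * c, hI z hz, by rw [mul_assoc, pow_succ']⟩
  have hJ : ∀ n, (Ideal.span {x}).mulRight (c ^ n) ≤ I.mulRight (c ^ n) := fun n y hy => by
    obtain ⟨z, hz, rfl⟩ := Ideal.mem_mulRight.1 hy
    obtain ⟨r, rfl⟩ := hspan z hz
    exact Ideal.mem_mulRight.2 ⟨r * x, I.mul_mem_left r hx, rfl⟩
  have hd : ∀ n, Disjoint ((Ideal.span {x}).mulRight (c ^ n)) (I.mulRight (c ^ (n + 1))) :=
    fun n => Submodule.disjoint_def.2 fun y hy hy' => by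
      obtain ⟨z, hz, rfl⟩ := Ideal.mem_mulRight.1 hy
      obtain ⟨r, rfl⟩ := hspan z hz
      obtain ⟨w, hw, hwe⟩ := Ideal.mem_mulRight.1 hy'
      have h1 : r * x = w * c := by
        refine (sub_eq_zero.1 (hcn n _ (I.sub_mem (hI w hw) (I.mul_mem_left r hx)) ?_)).symm
        rw [sub_mul, ← hwe, pow_succ', mul_assoc, sub_self]
      rw [hcon r (Ideal.mem_mulRight.2 ⟨w, hw, h1.symm⟩), zero_mul]
  obtain ⟨n, hn⟩ := h.exists_eq_bot hL hJ hd
  have hxn : x * c ^ n ∈ (Ideal.span {x}).mulRight (c ^ n) :=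
    Ideal.mem_mulRight.2 ⟨x, Ideal.mem_span_singleton_self x, rfl⟩
  rw [hn] at hxn
  exact hx0 (hcn n x hx hxn)

/-! ### The chain condition on left annihilators -/

theorem HasACCLeftAnnihilators.exists_maximal (h : HasACCLeftAnnihilators R) {ι : Type*}
    (X : ι → Set R) {P : ι → Prop} (hP : ∃ i, P i) :
    ∃ i, P i ∧ ∀ j, P j → leftAnnihilator (X i) ≤ leftAnnihilator (X j) →
      leftAnnihilator (X j) ≤ leftAnnihilator (X i) := by
  let f : ι → {J : Ideal R // ∃ X : Set R, J = leftAnnihilator X} :=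
    fun i => ⟨leftAnnihilator (X i), X i, rfl⟩
  obtain ⟨i, hi⟩ := hP
  obtain ⟨-, ⟨j, hj, rfl⟩, hm⟩ := h.wf.has_min (f '' {i | P i}) ⟨f i, i, hi, rfl⟩
  refine ⟨j, hj, fun k hk hle => ?_⟩
  by_contra hn
  exact hm (f k) ⟨k, hk, rfl⟩ (lt_of_le_not_ge hle hn)

theorem IsSemiprimeRing.mul_mul_eq_zero_comm (hs : IsSemiprimeRing R) {x y : R}
    (h : ∀ r, x * r * y = 0) (r : R) : y * r * x = 0 :=
  hs _ fun t => by
    calc y * r * x * t * (y * r * x) = y * r * (x * t * y) * r * x := by noncomm_ring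
      _ = 0 := by rw [h]; simp

/-- In a semiprime ring with the ascending chain condition on left annihilators every nonzero
left ideal contains an element that is not nilpotent. -/
theorem IsSemiprimeRing.exists_not_isNilpotent (hs : IsSemiprimeRing R)
    (hacc : HasACCLeftAnnihilators R) {E : Ideal R} (hE : E ≠ ⊥) : ∃ a ∈ E, ¬ IsNilpotent a := by
  by_contra hnil
  push Not at hnil
  obtain ⟨e, he, he0⟩ := Submodule.exists_mem_ne_zero_of_ne_bot hE
  obtain ⟨a, ⟨ha, ha0⟩, hmax⟩ := hacc.exists_maximal (fun x : R => {x})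
    (P := fun x => x ∈ E ∧ x ≠ 0) ⟨e, he, he0⟩
  refine ha0 (hs a fun r => ?_)
  have hex : ∃ k : ℕ, a * (r * a) ^ k = 0 := by
    obtain ⟨k, hk⟩ := hnil (r * a) (E.mul_mem_left r ha)
    exact ⟨k, by rw [hk, mul_zero]⟩
  classical
  obtain ⟨k, hk⟩ : ∃ k, Nat.find hex = k + 1 := by
    refine Nat.exists_eq_succ_of_ne_zero fun h0 => ha0 ?_
    have := Nat.find_spec hex
    rwa [h0, pow_zero, mul_one] at this
  have h1 : a * (r * a) ^ k ≠ 0 := Nat.find_min hex (by omega)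
  have h2 : a * (r * a) ^ (k + 1) = 0 := hk ▸ Nat.find_spec hex
  have h3 : a * (r * a) ^ k ∈ E := by
    rcases k with _ | k
    · simpa using ha
    · rw [pow_succ, ← mul_assoc, ← mul_assoc]
      exact E.mul_mem_left _ ha
  have h4 := hmax _ ⟨h3, h1⟩ (fun z hz y hy => by
    rw [Set.mem_singleton_iff.1 hy, ← mul_assoc, hz a rfl, zero_mul])
  have h5 : a * r ∈ leftAnnihilator {a * (r * a) ^ k} := by
    rintro y rfl
    rw [← h2, pow_succ', mul_assoc, mul_assoc]
  exact h4 h5 a rfl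

theorem IsSemiprimeRing.exists_annihilator_sq (hs : IsSemiprimeRing R)
    (hacc : HasACCLeftAnnihilators R) {E : Ideal R} (hE : E ≠ ⊥) :
    ∃ a ∈ E, a ≠ 0 ∧ ∀ x, x * (a * a) = 0 → x * a = 0 := by
  obtain ⟨u, hu, hnil⟩ := hs.exists_not_isNilpotent hacc hE
  obtain ⟨n, hn, hmax⟩ := hacc.exists_maximal (fun n : ℕ => {u ^ n}) (P := fun n => n ≠ 0)
    ⟨1, one_ne_zero⟩
  refine ⟨u ^ n, E.pow_mem_of_mem hu n (Nat.pos_of_ne_zero hn),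
    fun h => hnil ⟨n, h⟩, fun x hx => ?_⟩
  refine hmax (n + n) (by omega) (fun z hz y hy => ?_) (?_ : x ∈ _) _ rfl
  · rw [Set.mem_singleton_iff.1 hy, pow_add, ← mul_assoc, hz _ rfl, zero_mul]
  · rintro y rfl
    rwa [pow_add]

/-- A semiprime ring with the ascending chain condition on left annihilators is left
nonsingular. -/
theorem IsSemiprimeRing.eq_zero_of_isEssentialLeft (hs : IsSemiprimeRing R)
    (hacc : HasACCLeftAnnihilators R) {z : R} (hz : IsEssentialLeft (leftAnnihilator {z})) :
    z = 0 := by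
  by_contra h0
  obtain ⟨a, ha, ha0, hsq⟩ := hs.exists_annihilator_sq hacc (E := Ideal.span {z}) (by simpa using h0)
  obtain ⟨r, rfl⟩ := Ideal.mem_span_singleton'.1 ha
  have hess : IsEssentialLeft (leftAnnihilator {r * z}) := (hz.colonRight r).mono fun x hx => by
    rintro y rfl
    rw [← mul_assoc]
    exact hx z rfl
  obtain ⟨t, ht, hne⟩ := hess _ ha0
  refine hne (hsq t ?_)
  rw [← mul_assoc]
  exact ht _ rfl

/-! ### Regular elements in essential left ideals -/

theorem IsSemiprimeRing.exists_mul_eq_zero_imp (hs : IsSemiprimeRing R) (hg : IsLeftGoldieRing R)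
    {E : Ideal R} (hE : IsEssentialLeft E) : ∃ c ∈ E, ∀ x, x * c = 0 → x = 0 := by
  by_contra hcon
  push Not at hcon
  let T := {c : R // c ∈ E ∧ ∀ x, x * (c * c) = 0 → x * c = 0}
  have step : ∀ c : T, ∃ (c' : T) (a : R), a ≠ 0 ∧ a ∈ leftAnnihilator {c.1} ∧
      leftAnnihilator {c'.1} ≤ leftAnnihilator {c.1} ∧
      Disjoint (Ideal.span {a}) (leftAnnihilator {c'.1}) := by
    rintro ⟨c, hcE, hc⟩
    have hne : E ⊓ leftAnnihilator {c} ≠ ⊥ := by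
      obtain ⟨x, hx, hx0⟩ := hcon c hcE
      obtain ⟨r, hr, hr0⟩ := hE x hx0
      refine (Submodule.ne_bot_iff _).2 ⟨r * x, ⟨hr, ?_⟩, hr0⟩
      rintro y rfl
      rw [mul_assoc, hx, mul_zero]
    obtain ⟨a, ⟨haE, hac⟩, ha0, ha⟩ := hs.exists_annihilator_sq hg.acc_leftAnnihilators hne
    replace hac : a * c = 0 := hac c rfl
    have hca : ∀ x, x * (c + a) = 0 → x * c = 0 ∧ x * a = 0 := by
      intro x hx
      have h1 : x * c = 0 := hc x <| by
        calc x * (c * c) = x * (c + a) * c - x * (a * c) := by noncomm_ring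
          _ = 0 := by rw [hx, hac]; simp
      rw [mul_add, h1, zero_add] at hx
      exact ⟨h1, hx⟩
    refine ⟨⟨c + a, E.add_mem hcE haE, fun x hx => ?_⟩, a, ha0, ?_, ?_, ?_⟩
    · have h1 : x * c = 0 := hc x <| by
        rw [← mul_assoc]
        refine hc (x * c) ?_
        calc x * c * (c * c) = x * ((c + a) * (c + a)) * c - x * (c + a) * (a * c)
              - x * (a * c) * c := by noncomm_ring
          _ = 0 := by rw [hx, hac]; simp
      have h2 : x * a = 0 := ha x <| by
        calc x * (a * a) = x * ((c + a) * (c + a)) - x * c * (c + a) - x * (a * c) := by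
              noncomm_ring
          _ = 0 := by rw [hx, hac, h1]; simp
      rw [mul_add, h1, h2, add_zero]
    · rintro y rfl
      exact hac
    · rintro x hx y rfl
      exact (hca x (hx _ rfl)).1
    · refine Submodule.disjoint_def.2 fun x hx hx' => ?_
      obtain ⟨r, rfl⟩ := Ideal.mem_span_singleton'.1 hx
      refine ha r ?_
      rw [← mul_assoc]
      exact (hca _ (hx' _ rfl)).2
  choose next a ha0 hac hle hdis using step
  let c : ℕ → T := fun n => next^[n] ⟨0, E.zero_mem, by simp⟩
  have hcs : ∀ n, c (n + 1) = next (c n) := fun n => Function.iterate_succ_apply' _ _ _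
  obtain ⟨n, hn⟩ := hg.finite_udim.exists_eq_bot (L := fun n => leftAnnihilator {(c n).1})
    (J := fun n => Ideal.span {a (c n)})
    (antitone_nat_of_succ_le fun n => by rw [hcs]; exact hle _)
    (fun n => by rw [Ideal.span_singleton_le_iff_mem]; exact hac _)
    (fun n => by rw [hcs]; exact hdis _)
  exact ha0 _ (Ideal.span_singleton_eq_bot.1 hn)

/-- In a semiprime left Goldie ring an element with zero left annihilator is regular. -/
theorem IsSemiprimeRing.mem_nonZeroDivisors (hs : IsSemiprimeRing R) (hg : IsLeftGoldieRing R)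
    {c : R} (hc : ∀ x, x * c = 0 → x = 0) : c ∈ nonZeroDivisors R := by
  refine ⟨fun y hy => ?_, hc⟩
  refine hs.eq_zero_of_isEssentialLeft hg.acc_leftAnnihilators (fun x hx => ?_)
  obtain ⟨r, hr, hr0⟩ := hg.finite_udim.exists_mul_mem_mulRight (I := ⊤) (c := c)
    (fun _ _ => trivial) (fun y _ => hc y) (x := x) trivial hx
  refine ⟨r, ?_, hr0⟩
  obtain ⟨t, -, ht⟩ := Ideal.mem_mulRight.1 hr
  rintro z rfl
  rw [← ht, mul_assoc, hy, mul_zero]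

/-- **Goldie's lemma**: an essential left ideal of a semiprime left Goldie ring contains a regular
element. -/
theorem IsEssentialLeft.exists_mem_nonZeroDivisors (hs : IsSemiprimeRing R)
    (hg : IsLeftGoldieRing R) {E : Ideal R} (hE : IsEssentialLeft E) :
    ∃ c ∈ E, c ∈ nonZeroDivisors R := by
  obtain ⟨c, hcE, hc⟩ := hs.exists_mul_eq_zero_imp hg hE
  exact ⟨c, hcE, hs.mem_nonZeroDivisors hg hc⟩

end Goldie

/-! ### Minimal primes of a semiprime left Goldie ring -/

section MinimalPrimes

variable {R : Type u} [Ring R]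

/-- Two-sided ideals `p` and `b` such that `p` is both the left and the right annihilator
of `b`. -/
structure IsAnnihilatorOf (p b : TwoSidedIdeal R) : Prop where
  mem_iff_left : ∀ x, x ∈ p ↔ ∀ z ∈ b, x * z = 0
  mem_iff_right : ∀ x, x ∈ p ↔ ∀ z ∈ b, z * x = 0

theorem IsAnnihilatorOf.eq_zero {p b : TwoSidedIdeal R} (h : IsAnnihilatorOf p b)
    (hs : IsSemiprimeRing R) {x : R} (hp : x ∈ p) (hb : x ∈ b) : x = 0 :=
  hs x fun r => (h.mem_iff_left _).1 (p.mul_mem_right x r hp) x hb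

/-- In a semiprime ring with the ascending chain condition on left annihilators, every nonzero
element is avoided by a minimal prime that is an annihilator. -/
theorem IsSemiprimeRing.exists_minPrimes_notMem (hs : IsSemiprimeRing R)
    (hacc : HasACCLeftAnnihilators R) {x : R} (hx : x ≠ 0) :
    ∃ p ∈ minPrimes R, x ∉ p ∧ ∃ b, IsAnnihilatorOf p b := by
  obtain ⟨y, ⟨hyx, hy0⟩, hmax⟩ := hacc.exists_maximal (fun y : R => Set.range (· * y))
    (P := fun y => y ∈ TwoSidedIdeal.span {x} ∧ y ≠ 0) ⟨x, TwoSidedIdeal.subset_span rfl, hx⟩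
  let p : TwoSidedIdeal R := TwoSidedIdeal.mk' {z | ∀ r, z * (r * y) = 0}
    (fun r => zero_mul _) (fun {a b} ha hb r => by rw [add_mul, ha r, hb r, add_zero])
    (fun {a} ha r => by rw [neg_mul, ha r, neg_zero])
    (fun {a b} hb r => by rw [mul_assoc, hb r, mul_zero])
    (fun {a b} ha r => by rw [mul_assoc, ← mul_assoc b, ha])
  have hp : ∀ z, z ∈ p ↔ ∀ r, z * (r * y) = 0 := fun z => TwoSidedIdeal.mem_mk' ..
  have hyp : y ∉ p := fun h => hy0 (hs y fun r => by rw [mul_assoc]; exact (hp y).1 h r)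
  let b : TwoSidedIdeal R := TwoSidedIdeal.mk' {w | ∀ z ∈ p, z * w = 0}
    (fun z _ => mul_zero z) (fun {a b} ha hb z hz => by rw [mul_add, ha z hz, hb z hz, add_zero])
    (fun {a} ha z hz => by rw [mul_neg, ha z hz, neg_zero])
    (fun {a b} hb z hz => by rw [← mul_assoc, hb _ (p.mul_mem_right z a hz)])
    (fun {a b} ha z hz => by rw [← mul_assoc, ha z hz, zero_mul])
  have hb : ∀ w, w ∈ b ↔ ∀ z ∈ p, z * w = 0 := fun w => TwoSidedIdeal.mem_mk' ..
  have hyb : y ∈ b := (hb y).2 fun z hz => by simpa using (hp z).1 hz 1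
  have hprime : IsPrimeTwoSided p := by
    refine ⟨fun h => hyp (by rw [h]; trivial), fun a b' hab => or_iff_not_imp_right.2 fun hb' => ?_⟩
    rw [hp] at hb'
    push Not at hb'
    obtain ⟨r, hr⟩ := hb'
    have h1 := hmax (b' * (r * y)) ⟨TwoSidedIdeal.mul_mem_left _ _ _
      (TwoSidedIdeal.mul_mem_left _ _ _ hyx), hr⟩ (by
        rintro z hz _ ⟨t, rfl⟩
        have := hz ((t * b' * r) * y) ⟨_, rfl⟩
        simpa only [mul_assoc] using this)
    refine (hp a).2 fun t => h1 (?_ : a ∈ _) _ ⟨t, rfl⟩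
    rintro _ ⟨t, rfl⟩
    have := (hp _).1 (hab t) r
    simpa only [mul_assoc] using this
  refine ⟨p, ⟨hprime, fun q hq hqp z hz => ?_⟩, fun hxp => hyp ?_, b,
    ⟨fun z => ⟨fun hz w hw => (hb w).1 hw z hz,
      fun h => (hp z).2 fun r => h _ (b.mul_mem_left r y hyb)⟩,
      fun z => ⟨fun hz w hw => ?_, fun h => ?_⟩⟩⟩
  · refine (hq.2 z y fun r => ?_).resolve_right fun h => hyp (hqp h)
    rw [mul_assoc, (hp z).1 hz r]
    exact q.zero_mem
  · exact (TwoSidedIdeal.span_le (I := p)).2 (by simpa using hxp) hyx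
  · simpa using hs.mul_mul_eq_zero_comm (x := z) (y := w)
      (fun r => (hb w).1 hw _ (p.mul_mem_right z r hz)) 1
  · refine (hp z).2 fun r => ?_
    rw [← mul_assoc]
    exact hs.mul_mul_eq_zero_comm (fun r => h _ (b.mul_mem_right y r hyb)) r

/-- In a semiprime ring with the ascending chain condition on left annihilators every minimal
prime is an annihilator. -/
theorem IsSemiprimeRing.exists_isAnnihilatorOf (hs : IsSemiprimeRing R)
    (hacc : HasACCLeftAnnihilators R) {q : TwoSidedIdeal R} (hq : q ∈ minPrimes R) :
    ∃ b, IsAnnihilatorOf q b := by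
  have hne : ∃ y, y ∉ q := by
    by_contra h
    push Not at h
    exact hq.1.1 (top_le_iff.1 fun x _ => h x)
  obtain ⟨y, hy, hmax⟩ := hacc.exists_maximal (fun y : R => Set.range (· * y)) hne
  obtain ⟨p, hp, hyp, b, hb⟩ := hs.exists_minPrimes_notMem hacc
    (fun h : y = 0 => hy (by rw [h]; exact q.zero_mem))
  suffices h : p ≤ q by
    rw [← le_antisymm h (hq.2 hp.1 h)]
    exact ⟨b, hb⟩
  intro z hz
  by_contra hzq
  obtain ⟨r, hr⟩ : ∃ r, y * r * z ∉ q := by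
    by_contra h
    push Not at h
    exact (hq.1.2 y z h).elim hy hzq
  refine hyp ((hb.mem_iff_right y).2 fun w hw => ?_)
  have h1 := hmax _ hr (by
    rintro x hx _ ⟨t, rfl⟩
    have := hx (t * y) ⟨t, rfl⟩
    simp only [← mul_assoc] at this ⊢
    rw [this, zero_mul, zero_mul])
  have h2 : w ∈ leftAnnihilator (Set.range (· * (y * r * z))) := by
    rintro _ ⟨t, rfl⟩
    exact (hb.mem_iff_right _).1 (p.mul_mem_left _ _ (p.mul_mem_left _ _ hz)) w hw
  simpa using h1 h2 _ ⟨1, rfl⟩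

/-- A two-sided ideal of a semiprime left Goldie ring without regular elements lies in a minimal
prime. -/
theorem IsSemiprimeRing.exists_minPrimes_le (hs : IsSemiprimeRing R) (hg : IsLeftGoldieRing R)
    {a : TwoSidedIdeal R} (ha : ∀ c ∈ nonZeroDivisors R, c ∉ a) : ∃ p ∈ minPrimes R, a ≤ p := by
  by_contra hcon
  push Not at hcon
  have hess : IsEssentialLeft a.asIdeal := by
    intro x hx
    obtain ⟨p, hp, hxp, -⟩ := hs.exists_minPrimes_notMem hg.acc_leftAnnihilators hx
    obtain ⟨y, hya, hyp⟩ := SetLike.not_le_iff_exists.1 (hcon p hp)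
    have : ∃ r, y * r * x ∉ p := by
      by_contra h
      push Not at h
      exact (hp.1.2 y x h).elim hyp hxp
    obtain ⟨r, hr⟩ := this
    exact ⟨y * r, TwoSidedIdeal.mem_asIdeal.2 (a.mul_mem_right _ _ (a.mul_mem_right _ _ hya)),
      fun h => hr (by rw [h]; exact p.zero_mem)⟩
  obtain ⟨c, hca, hc⟩ := hess.exists_mem_nonZeroDivisors hs hg
  exact ha c hc (TwoSidedIdeal.mem_asIdeal.1 hca)

/-! ### The sets `C(p)` -/

theorem mem_regularModulo {p : TwoSidedIdeal R} {c : R} :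
    c ∈ regularModulo p ↔ (∀ x, c * x ∈ p → x ∈ p) ∧ ∀ x, x * c ∈ p → x ∈ p := by
  have h0 : ∀ x : R, p.ringCon.mk' x = 0 ↔ x ∈ p := fun x => by
    rw [← map_zero p.ringCon.mk', TwoSidedIdeal.mem_iff]
    exact RingCon.eq _
  constructor
  · rintro ⟨h1, h2⟩
    refine ⟨fun x hx => (h0 x).1 (h1 _ ?_), fun x hx => (h0 x).1 (h2 _ ?_)⟩ <;>
    rwa [← map_mul, h0]
  · rintro ⟨h1, h2⟩
    refine ⟨fun y hy => ?_, fun y hy => ?_⟩ <;>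
    obtain ⟨x, rfl⟩ := RingCon.mk'_surjective p.ringCon y <;>
    rw [← map_mul, h0] at hy <;>
    rw [h0]
    exacts [h1 x hy, h2 x hy]

theorem IsPrimeTwoSided.notMem_of_mem_regularModulo {p : TwoSidedIdeal R} (hp : IsPrimeTwoSided p)
    {c : R} (hc : c ∈ regularModulo p) : c ∉ p := fun h =>
  hp.1 (top_le_iff.1 fun x _ => (mem_regularModulo.1 hc).1 x (p.mul_mem_right c x h))

namespace IsAnnihilatorOf

variable {p b : TwoSidedIdeal R}

theorem nonZeroDivisors_le (h : IsAnnihilatorOf p b) : nonZeroDivisors R ≤ regularModulo p := by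
  intro d hd
  refine mem_regularModulo.2 ⟨fun x hx => (h.mem_iff_left x).2 fun z hz => hd.1 _ ?_,
    fun x hx => (h.mem_iff_right x).2 fun z hz => hd.2 _ ?_⟩
  · rw [← mul_assoc]
    exact (h.mem_iff_left _).1 hx z hz
  · rw [mul_assoc]
    exact (h.mem_iff_right _).1 hx z hz

theorem isEssentialLeft_sup (h : IsAnnihilatorOf p b) {E : Ideal R}
    (hE : ∀ x ∈ b, x ≠ 0 → ∃ r, r * x ∈ E ∧ r * x ≠ 0) : IsEssentialLeft (E ⊔ p.asIdeal) := by
  intro x hx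
  by_cases hxp : x ∈ p
  · rw [← one_mul x] at hxp hx
    exact ⟨1, Ideal.mem_sup_right (TwoSidedIdeal.mem_asIdeal.2 hxp), hx⟩
  · rw [h.mem_iff_right] at hxp
    push Not at hxp
    obtain ⟨z, hz, hzx⟩ := hxp
    obtain ⟨r, hr, hr0⟩ := hE _ (b.mul_mem_right z x hz) hzx
    rw [← mul_assoc] at hr hr0
    exact ⟨r * z, Ideal.mem_sup_left hr, hr0⟩

theorem exists_mem_regularModulo (h : IsAnnihilatorOf p b) (hs : IsSemiprimeRing R)
    (hg : IsLeftGoldieRing R) :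
    ∃ e ∈ b, e ∈ regularModulo p := by
  obtain ⟨d, hd, hreg⟩ := (h.isEssentialLeft_sup (E := b.asIdeal) fun x hx hx0 =>
    ⟨1, by simpa using hx, by simpa using hx0⟩).exists_mem_nonZeroDivisors hs hg
  obtain ⟨e, he, z, hz, rfl⟩ := Submodule.mem_sup.1 hd
  replace hz : z ∈ p := hz
  obtain ⟨h1, h2⟩ := mem_regularModulo.1 (h.nonZeroDivisors_le hreg)
  refine ⟨e, he, mem_regularModulo.2 ⟨fun x hx => h1 x ?_, fun x hx => h2 x ?_⟩⟩
  · rw [add_mul]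
    exact p.add_mem hx (p.mul_mem_right z x hz)
  · rw [mul_add]
    exact p.add_mem hx (p.mul_mem_left x z hz)

theorem isLeftDenominatorSet (h : IsAnnihilatorOf p b) (hs : IsSemiprimeRing R)
    (hg : IsLeftGoldieRing R) (hp : IsPrimeTwoSided p) : IsLeftDenominatorSet (regularModulo p) := by
  obtain ⟨e, heb, he⟩ := h.exists_mem_regularModulo hs hg
  refine (isLeftDenominatorSet_iff _).2 ⟨fun h0 => hp.notMem_of_mem_regularModulo h0 p.zero_mem,
    fun r c hc => ?_, fun r c hc hrc => ⟨e, he, ?_⟩⟩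
  · have hess : IsEssentialLeft (b.asIdeal.mulRight c ⊔ p.asIdeal) := by
      refine h.isEssentialLeft_sup fun x hx hx0 =>
        hg.finite_udim.exists_mul_mem_mulRight (I := b.asIdeal)
          (fun y hy => TwoSidedIdeal.mem_asIdeal.2 (b.mul_mem_right y c hy))
          (fun y hy hyc => h.eq_zero hs ?_ hy) hx hx0
      refine (mem_regularModulo.1 hc).2 y ?_
      rw [hyc]
      exact p.zero_mem
    obtain ⟨x, hx, hxr⟩ := (hess.colonRight r).exists_mem_nonZeroDivisors hs hg
    obtain ⟨_, ⟨y, -, rfl⟩, z, hz, hyz⟩ := Submodule.mem_sup.1 (Ideal.mem_colonRight.1 hx)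
    refine ⟨e * x, mul_mem he (h.nonZeroDivisors_le hxr), e * y, ?_⟩
    replace hyz : y * c + z = x * r := hyz
    rw [mul_assoc, ← hyz, mul_add, (h.mem_iff_right z).1 hz e heb, add_zero, mul_assoc]
  · refine (h.mem_iff_right r).1 ((mem_regularModulo.1 hc).2 r ?_) e heb
    rw [hrc]
    exact p.zero_mem

end IsAnnihilatorOf

theorem IsSemiprimeRing.eq_of_regularModulo_le (hs : IsSemiprimeRing R) (hg : IsLeftGoldieRing R)
    {p q : TwoSidedIdeal R} (hp : p ∈ minPrimes R) (hq : q ∈ minPrimes R)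
    (hle : regularModulo p ≤ regularModulo q) : p = q := by
  obtain ⟨b, hb⟩ := hs.exists_isAnnihilatorOf hg.acc_leftAnnihilators hp
  obtain ⟨e, heb, he⟩ := hb.exists_mem_regularModulo hs hg
  have h1 : p ≤ q := fun z hz => by
    refine (hq.1.2 z e fun r => ?_).resolve_right (hq.1.notMem_of_mem_regularModulo (hle he))
    rw [(hb.mem_iff_left _).1 (p.mul_mem_right z r hz) e heb]
    exact q.zero_mem
  exact le_antisymm h1 (hq.2 hp.1 h1)

/-- If a homomorphism from a semiprime left Goldie ring `R` to a nonzero ring inverts a submonoid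
`S` and kills no regular element, then `S ⊆ C(p)` for some minimal prime `p`. -/
theorem IsSemiprimeRing.exists_le_regularModulo (hs : IsSemiprimeRing R) (hg : IsLeftGoldieRing R)
    {A : Type*} [Ring A] (φ : R →+* A) {S : Submonoid R} (hS : ∀ s ∈ S, IsUnit (φ s))
    (hφ : ∀ c ∈ nonZeroDivisors R, φ c ≠ 0) : ∃ p ∈ minPrimes R, S ≤ regularModulo p := by
  have hker : ∀ x, x ∈ TwoSidedIdeal.ker φ ↔ φ x = 0 := fun x => TwoSidedIdeal.mem_ker φ
  obtain ⟨p, hp, hle⟩ := hs.exists_minPrimes_le hg (a := TwoSidedIdeal.ker φ)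
    fun c hc h => hφ c hc ((hker c).1 h)
  obtain ⟨b, hb⟩ := hs.exists_isAnnihilatorOf hg.acc_leftAnnihilators hp
  refine ⟨p, hp, fun t ht => mem_regularModulo.2 ⟨fun x hx => ?_, fun x hx => ?_⟩⟩
  · refine (hb.mem_iff_left x).2 fun z hz => hb.eq_zero hs (hle ((hker _).2 ?_))
      (b.mul_mem_left x z hz)
    rw [← (hS t ht).mul_right_eq_zero, ← map_mul, ← mul_assoc, (hb.mem_iff_left _).1 hx z hz,
      map_zero]
  · refine (hb.mem_iff_right x).2 fun z hz => hb.eq_zero hs (hle ((hker _).2 ?_))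
      (b.mul_mem_right z x hz)
    rw [← (hS t ht).mul_left_eq_zero, ← map_mul, mul_assoc, (hb.mem_iff_right _).1 hx z hz,
      map_zero]

end MinimalPrimes

/-! ### Localizations -/

section Localization

variable {R : Type u} [Ring R]

theorem IsLeftDenominatorSet.exists_le_regularModulo (hs : IsSemiprimeRing R)
    (hg : IsLeftGoldieRing R) {S : Submonoid R} (hS : IsLeftDenominatorSet S) :
    ∃ p ∈ minPrimes R, S ≤ regularModulo p := by
  obtain ⟨h0, ⟨hore⟩⟩ := hS
  refine hs.exists_le_regularModulo hg (OreLocalization.numeratorRingHom (S := S))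
    (fun s hs => OreLocalization.numerator_isUnit ⟨s, hs⟩) fun c hc h => h0 ?_
  rw [← map_zero (OreLocalization.numeratorRingHom (S := S))] at h
  obtain ⟨u, v, huv, h1⟩ := OreLocalization.oreDiv_eq_iff.1 h
  have h2 : (u : R) = v := by simpa using h1
  have h3 : (u : R) * c = 0 := by rw [h2]; simpa using huv.symm
  rw [← hc.2 _ h3]
  exact u.2

variable (K : Type v) [CommRing K] [Algebra K R]

namespace Inverted

theorem of_mul_inv (S : Submonoid R) (s : S) : of K S s * inv K S s = 1 := by
  simpa [of, inv] using RingQuot.mkAlgHom_rel K (InvertRel.mul_inv (K := K) s)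

theorem inv_mul_of (S : Submonoid R) (s : S) : inv K S s * of K S s = 1 := by
  simpa [of, inv] using RingQuot.mkAlgHom_rel K (InvertRel.inv_mul (K := K) s)

theorem isUnit_of (S : Submonoid R) {s : R} (hs : s ∈ S) : IsUnit (of K S s) :=
  ⟨⟨_, _, of_mul_inv K S ⟨s, hs⟩, inv_mul_of K S ⟨s, hs⟩⟩, rfl⟩

/-- `R⟨S⁻¹⟩` is generated by the image of `R` and the inverses of the elements of `S`. -/
theorem induction {S : Submonoid R} {P : Inverted K S → Prop} (hof : ∀ r, P (of K S r))
    (hinv : ∀ s, P (inv K S s)) (hadd : ∀ x y, P x → P y → P (x + y))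
    (hmul : ∀ x y, P x → P y → P (x * y)) (z : Inverted K S) : P z := by
  obtain ⟨y, rfl⟩ := RingQuot.mkAlgHom_surjective K (InvertRel K S) z
  obtain ⟨x, rfl⟩ := RingQuot.mkAlgHom_surjective K (FreeExtRel K R S) y
  induction x using FreeAlgebra.induction with
  | grade0 k =>
    have := hof (algebraMap K R k)
    rw [AlgHom.commutes] at this
    rwa [AlgHom.commutes, AlgHom.commutes]
  | grade1 x =>
    rcases x with r | s
    · exact hof r
    · exact hinv s
  | mul a b ha hb =>
    rw [map_mul, map_mul]
    exact hmul _ _ ha hb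
  | add a b ha hb =>
    rw [map_add, map_add]
    exact hadd _ _ ha hb

/-- A homomorphism of `K`-algebras that inverts `S` factors through `R⟨S⁻¹⟩`. -/
theorem exists_algHom {S : Submonoid R} {A : Type*} [Ring A] [Algebra K A] (φ : R →ₐ[K] A)
    (hφ : ∀ s ∈ S, IsUnit (φ s)) : Nonempty (Inverted K S →ₐ[K] A) := by
  choose u hu using hφ
  let f₀ : FreeAlgebra K (R ⊕ S) →ₐ[K] A :=
    FreeAlgebra.lift K (Sum.elim φ fun s => ↑(u s s.2)⁻¹)
  let f₁ : FreeExt K R S →ₐ[K] A := RingQuot.liftAlgHom K ⟨f₀, by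
    rintro _ _ (⟨a, b⟩ | ⟨a, b⟩ | k) <;> simp [f₀]⟩
  have h₁ : ∀ x, f₁ (RingQuot.mkAlgHom K _ x) = f₀ x := RingQuot.liftAlgHom_mkAlgHom_apply K f₀ _
  have hincl : ∀ r, f₁ (FreeExt.incl K R S r) = φ r := fun r => (h₁ _).trans (by simp [f₀])
  have hvar : ∀ s : S, f₁ (FreeExt.var K R s) = ↑(u s s.2)⁻¹ :=
    fun s => (h₁ _).trans (by simp [f₀])
  refine ⟨RingQuot.liftAlgHom K ⟨f₁, ?_⟩⟩
  rintro _ _ (s | s)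
  · rw [map_mul, hincl, hvar, map_one, ← hu s s.2, Units.mul_inv]
  · rw [map_mul, hincl, hvar, map_one, ← hu s s.2, Units.inv_mul]

end Inverted

theorem IsLeftDenominatorSet.isLeftLocalizableSet {S : Submonoid R}
    (hS : IsLeftDenominatorSet S) : IsLeftLocalizableSet K S := by
  obtain ⟨h0, hO, -⟩ := (isLeftDenominatorSet_iff S).1 hS
  refine ⟨h0, ?_, fun z => ?_⟩
  · obtain ⟨-, ⟨hore⟩⟩ := hS
    have : Nontrivial (OreLocalization S R) := OreLocalization.nontrivial_iff.2 h0
    obtain ⟨f⟩ := Inverted.exists_algHom K (S := S) (A := OreLocalization S R)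
      { OreLocalization.numeratorRingHom (R := R) (S := S) with commutes' := fun k => rfl }
      (fun s hs => OreLocalization.numerator_isUnit ⟨s, hs⟩)
    exact f.toRingHom.domain_nontrivial
  · suffices h : ∃ (s : S) (r : R), Inverted.of K S s * z = Inverted.of K S r by
      obtain ⟨s, r, h⟩ := h
      exact ⟨s, r, by rw [← h, ← mul_assoc, Inverted.inv_mul_of, one_mul]⟩
    induction z using Inverted.induction with
    | hof r => exact ⟨1, r, by simp⟩
    | hinv s => exact ⟨s, 1, by rw [Inverted.of_mul_inv, map_one]⟩
    | hadd x y hx hy =>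
      obtain ⟨s, a, hx⟩ := hx
      obtain ⟨t, b, hy⟩ := hy
      obtain ⟨s', hs', t', hst⟩ := hO s t t.2
      refine ⟨⟨s' * s, mul_mem hs' s.2⟩, s' * a + t' * b, ?_⟩
      have h1 : Inverted.of K S (s' * s) * x = Inverted.of K S (s' * a) := by
        rw [map_mul, mul_assoc, hx, map_mul]
      have h2 : Inverted.of K S (s' * s) * y = Inverted.of K S (t' * b) := by
        rw [hst, map_mul, mul_assoc, hy, map_mul]
      rw [mul_add, h1, h2, map_add]
    | hmul x y hx hy =>
      obtain ⟨s, a, hx⟩ := hx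
      obtain ⟨t, b, hy⟩ := hy
      obtain ⟨s', hs', t', hst⟩ := hO a t t.2
      refine ⟨⟨s' * s, mul_mem hs' s.2⟩, t' * b, ?_⟩
      calc Inverted.of K S (s' * s) * (x * y)
          = Inverted.of K S s' * (Inverted.of K S s * x) * y := by simp only [map_mul, mul_assoc]
        _ = Inverted.of K S (s' * a) * y := by rw [hx, map_mul]
        _ = Inverted.of K S t' * (Inverted.of K S t * y) := by rw [hst, map_mul, mul_assoc]
        _ = Inverted.of K S (t' * b) := by rw [hy, map_mul]

variable {K}

theorem IsLeftLocalizableSet.exists_le_regularModulo (hs : IsSemiprimeRing R)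
    (hg : IsLeftGoldieRing R) {S : Submonoid R} (hS : IsLeftLocalizableSet K S)
    (hle : nonZeroDivisors R ≤ S) : ∃ p ∈ minPrimes R, S ≤ regularModulo p := by
  have := hS.nontrivial
  let φ : R →+* Inverted K S := (Inverted.of K S).toRingHom
  have hφ : ∀ s ∈ S, IsUnit (φ s) := fun s h => Inverted.isUnit_of K S h
  exact hs.exists_le_regularModulo hg (A := Inverted K S) φ hφ
    fun c hc h0 => (hφ c (hle hc)).ne_zero h0

end Localization

theorem mainTheorem2 {K : Type v} {R : Type u} [CommRing K] [Ring R] [Algebra K R]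
    (hsemiprime : IsSemiprimeRing R) (hgoldie : IsLeftGoldieRing R) :
    {S : Submonoid R | Maximal (IsLeftLocalizableSet K) S ∧ nonZeroDivisors R ≤ S} =
        {S : Submonoid R | Maximal IsLeftDenominatorSet S} ∧
      {S : Submonoid R | Maximal IsLeftDenominatorSet S} =
        {S : Submonoid R | ∃ p ∈ minPrimes R, S = regularModulo p} := by
  have hden : ∀ p ∈ minPrimes R,
      IsLeftDenominatorSet (regularModulo p) ∧ nonZeroDivisors R ≤ regularModulo p := by
    intro p hp
    obtain ⟨b, hb⟩ := hsemiprime.exists_isAnnihilatorOf hgoldie.acc_leftAnnihilators hp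
    exact ⟨hb.isLeftDenominatorSet hsemiprime hgoldie hp.1, hb.nonZeroDivisors_le⟩
  have hmax : ∀ p ∈ minPrimes R, ∀ S : Submonoid R, regularModulo p ≤ S →
      (∃ q ∈ minPrimes R, S ≤ regularModulo q) → S ≤ regularModulo p := by
    rintro p hp S hpS ⟨q, hq, hSq⟩
    rwa [hsemiprime.eq_of_regularModulo_le hgoldie hp hq (hpS.trans hSq)]
  have hD : {S : Submonoid R | Maximal IsLeftDenominatorSet S} =
      {S : Submonoid R | ∃ p ∈ minPrimes R, S = regularModulo p} := by
    ext S
    constructor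
    · intro hS
      obtain ⟨p, hp, hle⟩ := hS.1.exists_le_regularModulo hsemiprime hgoldie
      exact ⟨p, hp, le_antisymm hle (hS.2 (hden p hp).1 hle)⟩
    · rintro ⟨p, hp, rfl⟩
      exact ⟨(hden p hp).1, fun S hS hle => hmax p hp S hle
        (hS.exists_le_regularModulo hsemiprime hgoldie)⟩
  refine ⟨?_, hD⟩
  rw [hD]
  ext S
  constructor
  · rintro ⟨hS, hC⟩
    obtain ⟨p, hp, hle⟩ := hS.1.exists_le_regularModulo hsemiprime hgoldie hC
    exact ⟨p, hp, le_antisymm hle (hS.2 ((hden p hp).1.isLeftLocalizableSet K) hle)⟩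
  · rintro ⟨p, hp, rfl⟩
    exact ⟨⟨(hden p hp).1.isLeftLocalizableSet K, fun S hS hle => hmax p hp S hle
      (hS.exists_le_regularModulo hsemiprime hgoldie ((hden p hp).2.trans hle))⟩, (hden p hp).2⟩
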